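/- Let $H$ be a word hyperbolic group, that is, a group whose Cayley graph with respect to some finite generating set is Gromov hyperbolic. Let $Q$ be an infinite quasi-normal subgroup of $H$, that is, an infinite subgroup such that for every $g \in H$ the intersection $gQg^{-1} \cap Q$ has finite index in both $Q$ and $gQg^{-1}$. Let $S$ be any finite generating set of $H$, with word metric $d$ and Gromov products $(x\mid y) = \tfrac12\,(d(x,1)+d(y,1)-d(x,y))$. Then the limit set of $Q$ is the entire Gromov boundary $\partial H$ of the Cayley graph of $H$ with respect to $S$. Here $\partial H$ is the set of classes of sequences $(x_n)$ in $H$ with $(x_i \mid x_j) \to \infty$ as $i,j \to \infty$, where $(x_n)$ and $(y_n)$ are equivalent if $(x_i \mid y_j) \to \infty$ as $i,j\to\infty$, and the limit set of $Q$ is the set of all points of $\partial H$ that are represented by a sequence of elements of $Q$. -/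

import Mathlib

open Filter

namespace QuasiNormal

/-- A subgroup `Q` of a group `H` is quasi-normal if its commensurator
`{g | gQg⁻¹ ∩ Q has finite index in both gQg⁻¹ and Q}` is all of `H`. -/
def IsQuasiNormal {H : Type*} [Group H] (Q : Subgroup H) : Prop :=
  Subgroup.Commensurable.commensurator Q = ⊤

section Graph

variable {V : Type*} (Γ : SimpleGraph V)

/-- The Gromov product `(x | y)_w = (d(x,w) + d(y,w) - d(x,y)) / 2` of vertices of a graph, with
respect to the edge path metric. -/
noncomputable def gromovProduct (w x y : V) : ℝ :=
  ((Γ.dist x w : ℝ) + (Γ.dist y w : ℝ) - (Γ.dist x y : ℝ)) / 2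

/-- Gromov hyperbolicity of (the vertex set of) a connected graph: for some `δ`,
`(x | z)_w ≥ min ((x | y)_w) ((y | z)_w) - δ` for all vertices. -/
def IsGromovHyperbolic : Prop :=
  Γ.Connected ∧ ∃ δ : ℝ, ∀ w x y z : V,
    min (gromovProduct Γ w x y) (gromovProduct Γ w y z) - δ ≤ gromovProduct Γ w x z

/-- `(x_i | y_j)_w → ∞` as `i, j → ∞`. -/
def GromovDiverge (w : V) (x y : ℕ → V) : Prop :=
  Tendsto (fun p : ℕ × ℕ => gromovProduct Γ w (x p.1) (y p.2)) atTop atTop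

/-- Sequences of vertices that converge to infinity: `(x_i | x_j)_w → ∞` as `i, j → ∞`. -/
def ConvSeq (w : V) : Type _ :=
  {x : ℕ → V // GromovDiverge Γ w x x}

/-- The Gromov boundary: sequences converging to infinity, where `x` and `y` are identified if
`(x_i | y_j)_w → ∞`. On a hyperbolic graph this relation is an equivalence relation
(`gromovDiverge_equivalence` below). -/
def GromovBoundary (w : V) : Type _ :=
  Quot (fun x y : ConvSeq Γ w => GromovDiverge Γ w x.1 y.1)

/-- The boundary point to which a sequence converges. -/
def ConvSeq.lim {Γ : SimpleGraph V} {w : V} (x : ConvSeq Γ w) : GromovBoundary Γ w :=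
  Quot.mk _ x

/-- The limit set of a set `A` of vertices: all boundary points that are limits of sequences of
elements of `A`. -/
def limitSet (w : V) (A : Set V) : Set (GromovBoundary Γ w) :=
  {ξ | ∃ x : ConvSeq Γ w, (∀ n, x.1 n ∈ A) ∧ x.lim = ξ}

variable {Γ}

theorem gromovProduct_comm (w x y : V) : gromovProduct Γ w x y = gromovProduct Γ w y x := by
  unfold gromovProduct
  rw [Γ.dist_comm (u := x) (v := y)]
  ring

theorem GromovDiverge.symm {w : V} {x y : ℕ → V} (h : GromovDiverge Γ w x y) :
    GromovDiverge Γ w y x := by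
  unfold GromovDiverge at h ⊢
  rw [tendsto_atTop] at h ⊢
  intro b
  have e := h b
  rw [eventually_atTop] at e ⊢
  obtain ⟨a, ha⟩ := e
  refine ⟨(a.2, a.1), fun p hp => ?_⟩
  rw [gromovProduct_comm]
  exact ha (p.2, p.1) ⟨hp.2, hp.1⟩

theorem GromovDiverge.trans (hΓ : IsGromovHyperbolic Γ) {w : V} {x y z : ℕ → V}
    (h₁ : GromovDiverge Γ w x y) (h₂ : GromovDiverge Γ w y z) : GromovDiverge Γ w x z := by
  obtain ⟨-, δ, hδ⟩ := hΓ
  unfold GromovDiverge at h₁ h₂ ⊢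
  rw [tendsto_atTop] at h₁ h₂ ⊢
  intro b
  have e₁ := h₁ (b + δ)
  have e₂ := h₂ (b + δ)
  rw [eventually_atTop] at e₁ e₂ ⊢
  obtain ⟨a, ha⟩ := e₁
  obtain ⟨c, hc⟩ := e₂
  refine ⟨(a.1, c.2), fun p hp => ?_⟩
  have k₁ := ha (p.1, max a.2 c.1) ⟨hp.1, le_max_left _ _⟩
  have k₂ := hc (max a.2 c.1, p.2) ⟨le_max_right _ _, hp.2⟩
  have k := hδ w (x p.1) (y (max a.2 c.1)) (z p.2)
  have := le_min k₁ k₂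
  linarith

theorem gromovDiverge_equivalence (hΓ : IsGromovHyperbolic Γ) (w : V) :
    Equivalence (fun x y : ConvSeq Γ w => GromovDiverge Γ w x.1 y.1) where
  refl x := x.2
  symm h := h.symm
  trans h₁ h₂ := h₁.trans hΓ h₂

end Graph

/-- A group is word hyperbolic if its Cayley graph with respect to some finite generating set is
Gromov hyperbolic. -/
def IsWordHyperbolic (H : Type*) [Group H] : Prop :=
  ∃ S : Set H, S.Finite ∧ Subgroup.closure S = ⊤ ∧
    IsGromovHyperbolic (SimpleGraph.mulCayley S)

end QuasiNormal

/-!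
Every infinite subgroup contains an element `q` whose square is longer than `q` by more than
`3 * δ`: otherwise any finite set of its elements moves a suitable point by at most `26 * δ`, which
bounds the order of the subgroup by that of a ball. The powers `q ^ n` and `q ^ (-n)` leave `1` in
uniformly separated directions, so for every `g` one of the two, call it `r`, has bounded Gromov
product with `g⁻¹`. Quasi-normality puts `g * r * g⁻¹` in `Q` for suitable arbitrarily large `n`,
and then the geodesic from `1` to this element passes uniformly close to `g`. Hence every sequence
converging to a boundary point may be replaced by a sequence in `Q` with the same limit.

That hyperbolicity does not depend on the generating set is the stability of quasi-geodesics: a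
path avoiding the ball of radius `R` about a point of a geodesic joining its ends has length
exponential in `R`, whereas the relevant part of a quasi-geodesic has length linear in `R`.
-/

namespace QuasiNormal

section Hyperbolic

variable {V : Type*} {Γ : SimpleGraph V} {δ : ℝ}

theorem cast_dist_comm (Γ : SimpleGraph V) (x y : V) : (Γ.dist x y : ℝ) = Γ.dist y x := by
  rw [Γ.dist_comm]

theorem cast_dist_triangle (hΓ : Γ.Connected) (x y z : V) :
    (Γ.dist x z : ℝ) ≤ Γ.dist x y + Γ.dist y z := by
  exact_mod_cast hΓ.dist_triangle

theorem gromovProduct_nonneg (hΓ : Γ.Connected) (w x y : V) : 0 ≤ gromovProduct Γ w x y := by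
  have := cast_dist_triangle hΓ x w y
  have := cast_dist_comm Γ w y
  unfold gromovProduct
  linarith

theorem gromovProduct_self (w x : V) : gromovProduct Γ w x x = Γ.dist x w := by
  simp [gromovProduct]

theorem gromovProduct_base_left (w x : V) : gromovProduct Γ w w x = 0 := by
  simp [gromovProduct, Γ.dist_comm]

theorem gromovProduct_le_add_dist_base (hΓ : Γ.Connected) (w w' x y : V) :
    gromovProduct Γ w x y ≤ gromovProduct Γ w' x y + Γ.dist w w' := by
  have := cast_dist_triangle hΓ x w' w
  have := cast_dist_triangle hΓ y w' w
  have := cast_dist_comm Γ w w'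
  unfold gromovProduct
  linarith

/-- A connected graph is `δ`-hyperbolic if its path metric satisfies the four point inequality
with constant `δ`; this fixes the constant in `IsGromovHyperbolic`. -/
structure IsDeltaHyperbolic (Γ : SimpleGraph V) (δ : ℝ) : Prop where
  connected : Γ.Connected
  four_point : ∀ w x y z : V,
    min (gromovProduct Γ w x y) (gromovProduct Γ w y z) - δ ≤ gromovProduct Γ w x z

theorem isGromovHyperbolic_iff_exists :
    IsGromovHyperbolic Γ ↔ ∃ δ, IsDeltaHyperbolic Γ δ :=
  ⟨fun ⟨hΓ, δ, h⟩ => ⟨δ, hΓ, h⟩, fun ⟨δ, h⟩ => ⟨h.connected, δ, h.four_point⟩⟩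

namespace IsDeltaHyperbolic

theorem nonneg (h : IsDeltaHyperbolic Γ δ) : 0 ≤ δ := by
  obtain ⟨v⟩ := h.connected.nonempty
  simpa [gromovProduct] using h.four_point v v v v

theorem le_or_le (h : IsDeltaHyperbolic Γ δ) (w x y z : V) :
    gromovProduct Γ w x y ≤ gromovProduct Γ w x z + δ ∨
      gromovProduct Γ w y z ≤ gromovProduct Γ w x z + δ :=
  min_le_iff.1 (sub_le_iff_le_add.1 (h.four_point w x y z))

theorem le_or_le_or_le (h : IsDeltaHyperbolic Γ δ) (w x y z t : V) :
    gromovProduct Γ w x y ≤ gromovProduct Γ w x t + 2 * δ ∨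
      gromovProduct Γ w y z ≤ gromovProduct Γ w x t + 2 * δ ∨
        gromovProduct Γ w z t ≤ gromovProduct Γ w x t + 2 * δ := by
  have := h.nonneg
  rcases h.le_or_le w x y t with hxy | hyt
  · left; linarith
  · rcases h.le_or_le w y z t with hyz | hzt
    · right; left; linarith
    · right; right; linarith

theorem exists_gromovProduct_succ_le (h : IsDeltaHyperbolic Γ δ) (w : V) (k : ℕ) :
    ∀ (z : ℕ → V) (n : ℕ), 0 < n → n ≤ 2 ^ k →
      ∃ i < n, gromovProduct Γ w (z i) (z (i + 1)) ≤ gromovProduct Γ w (z 0) (z n) + k * δ := by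
  have hδ := h.nonneg
  induction k with
  | zero =>
    intro z n hn hnk
    obtain rfl : n = 1 := by simp only [pow_zero] at hnk; omega
    exact ⟨0, one_pos, by simp⟩
  | succ k ih =>
    intro z n hn hnk
    push_cast
    rcases le_or_gt n (2 ^ k) with hle | hlt
    · obtain ⟨i, hi, hzi⟩ := ih z n hn hle
      exact ⟨i, hi, by linarith⟩
    · rw [pow_succ] at hnk
      rcases h.le_or_le w (z 0) (z (2 ^ k)) (z n) with hfirst | hsecond
      · obtain ⟨i, hi, hzi⟩ := ih z (2 ^ k) (by positivity) le_rfl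
        exact ⟨i, by omega, by linarith⟩
      · obtain ⟨i, hi, hzi⟩ := ih (fun j => z (2 ^ k + j)) (n - 2 ^ k) (by omega) (by omega)
        simp only [add_zero, Nat.add_sub_cancel' hlt.le] at hzi
        exact ⟨2 ^ k + i, by omega, by rw [add_assoc]; linarith⟩

end IsDeltaHyperbolic

/-- The vertices `c 0, …, c n` form a geodesic. -/
def IsGeodesic (Γ : SimpleGraph V) (c : ℕ → V) (n : ℕ) : Prop :=
  ∀ ⦃i j⦄, i ≤ j → j ≤ n → Γ.dist (c i) (c j) = j - i

/-- The vertices `z 0, …, z n` form a quasi-geodesic: the path metric restricted to them agrees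
with the distance of the indices up to the factor `L`. -/
structure IsQuasiGeodesic (Γ : SimpleGraph V) (L : ℕ) (z : ℕ → V) (n : ℕ) : Prop where
  dist_le : ∀ ⦃i j⦄, i ≤ j → j ≤ n → Γ.dist (z i) (z j) ≤ L * (j - i)
  sub_le : ∀ ⦃i j⦄, i ≤ j → j ≤ n → j - i ≤ L * Γ.dist (z i) (z j)

theorem exists_isGeodesic (hΓ : Γ.Connected) (x y : V) :
    ∃ c : ℕ → V, c 0 = x ∧ c (Γ.dist x y) = y ∧ IsGeodesic Γ c (Γ.dist x y) := by
  obtain ⟨p, hp⟩ := hΓ.exists_walk_length_eq_dist x y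
  have h0 : p.getVert 0 = x := p.getVert_zero
  have hn : p.getVert (Γ.dist x y) = y := hp ▸ p.getVert_length
  refine ⟨p.getVert, h0, hn, fun i j hij hj => ?_⟩
  have hle : ∀ {i j}, i ≤ j → Γ.dist (p.getVert i) (p.getVert j) ≤ j - i := by
    intro i j hij
    have := (Γ.dist_le ((p.drop i).take (j - i))).trans
      (((p.drop i).take_length _).trans_le (min_le_left _ _))
    rwa [SimpleGraph.Walk.drop_getVert, Nat.add_sub_cancel' hij] at this
  have hxi := hle (Nat.zero_le i)
  have hjy := hle hj
  rw [h0] at hxi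
  rw [hn] at hjy
  have hxy := hΓ.dist_triangle (u := x) (v := p.getVert i) (w := y)
  have hiy := hΓ.dist_triangle (u := p.getVert i) (v := p.getVert j) (w := y)
  have := hle hij
  omega

theorem isGeodesic_zero (c : ℕ → V) : IsGeodesic Γ c 0 := by
  intro i j hij hj
  obtain rfl : i = j := by omega
  simp

namespace IsGeodesic

variable {c : ℕ → V} {n : ℕ}

theorem cast_dist (hc : IsGeodesic Γ c n) {i j : ℕ} (hij : i ≤ j) (hj : j ≤ n) :
    (Γ.dist (c i) (c j) : ℝ) = j - i := by
  rw [hc hij hj, Nat.cast_sub hij]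

theorem cast_dist_le_one (hc : IsGeodesic Γ c n) {i j : ℕ} (hij : i ≤ j) (hji : j ≤ i + 1)
    (hj : j ≤ n) : (Γ.dist (c i) (c j) : ℝ) ≤ 1 := by
  rw [hc.cast_dist hij hj, sub_le_iff_le_add']
  exact_mod_cast hji

theorem gromovProduct_eq_zero (hc : IsGeodesic Γ c n) {i j k : ℕ} (hij : i ≤ j) (hjk : j ≤ k)
    (hk : k ≤ n) : gromovProduct Γ (c j) (c i) (c k) = 0 := by
  rw [gromovProduct, cast_dist_comm Γ (c k), hc.cast_dist hij (hjk.trans hk), hc.cast_dist hjk hk,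
    hc.cast_dist (hij.trans hjk) hk]
  ring

end IsGeodesic

theorem exists_dist_eq_gromovProduct_eq (hΓ : Γ.Connected) {w p : V} {n : ℕ}
    (hn : n ≤ Γ.dist p w) : ∃ x, Γ.dist x w = n ∧ gromovProduct Γ w x p = n := by
  obtain ⟨c, hc0, hcN, hc⟩ := exists_isGeodesic hΓ w p
  rw [Γ.dist_comm] at hcN hc
  have hw : Γ.dist (c n) w = n := by
    rw [← hc0, Γ.dist_comm, hc n.zero_le hn, Nat.sub_zero]
  have hp := hc.cast_dist hn le_rfl
  rw [hcN] at hp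
  refine ⟨c n, hw, ?_⟩
  rw [gromovProduct, hw, hp]
  ring

theorem exists_adjacent_of_forall_or {P Q : ℕ → Prop} {N : ℕ} (hP : P 0) (hQ : Q N)
    (h : ∀ t ≤ N, P t ∨ Q t) : ∃ s t, s ≤ t ∧ t ≤ s + 1 ∧ t ≤ N ∧ P s ∧ Q t := by
  induction N with
  | zero => exact ⟨0, 0, le_rfl, zero_le_one, le_rfl, hP, hQ⟩
  | succ N ih =>
    rcases h N N.le_succ with hPN | hQN
    · exact ⟨N, N + 1, N.le_succ, le_rfl, le_rfl, hPN, hQ⟩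
    · obtain ⟨s, t, hst, hts, htN, hs, ht⟩ := ih hQN fun t ht => h t (ht.trans N.le_succ)
      exact ⟨s, t, hst, hts, htN.trans N.le_succ, hs, ht⟩

theorem IsQuasiGeodesic.exists_dist_le {L : ℕ} {z : ℕ → V} {n : ℕ} (hz : IsQuasiGeodesic Γ L z n)
    (h : IsDeltaHyperbolic Γ δ) (p : V) {i j k : ℕ} (hi : i ≤ n) (hj : j ≤ n)
    (hk : L * Γ.dist (z i) (z j) ≤ 2 ^ k) :
    ∃ m ≤ n, (Γ.dist p (z m) : ℝ) ≤ gromovProduct Γ p (z i) (z j) + k * δ + L := by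
  wlog hij : i ≤ j generalizing i j
  · rw [gromovProduct_comm]
    exact this hj hi (by rwa [Γ.dist_comm]) (le_of_not_ge hij)
  have hδ := h.nonneg
  rcases hij.eq_or_lt with rfl | hlt
  · refine ⟨i, hi, ?_⟩
    rw [gromovProduct_self, cast_dist_comm, add_assoc]
    exact le_add_of_nonneg_right (by positivity)
  · obtain ⟨m, hm, hmk⟩ := h.exists_gromovProduct_succ_le p k (fun s => z (i + s)) (j - i)
      (by omega) ((hz.sub_le hij hj).trans hk)
    simp only [add_zero, Nat.add_sub_cancel' hij, ← add_assoc] at hmk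
    refine ⟨i + m, by omega, ?_⟩
    have hstep : (Γ.dist (z (i + m)) (z (i + m + 1)) : ℝ) ≤ L := by
      exact_mod_cast (hz.dist_le (by omega) (by omega)).trans (by simp)
    have htri := cast_dist_triangle h.connected (z (i + m)) (z (i + m + 1)) p
    rw [cast_dist_comm Γ p]
    unfold gromovProduct at hmk ⊢
    linarith

theorem exists_mem_le_gromovProduct {A : Set V} {R : ℕ} {a p : V} (hfar : ∀ v ∈ A, R ≤ Γ.dist v p)
    (hnear : ∃ v ∈ A, Γ.dist a v ≤ R) (ha : a ∈ A ∨ 2 * R ≤ Γ.dist a p) :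
    ∃ v ∈ A, Γ.dist a v ≤ R ∧ (R : ℝ) ≤ gromovProduct Γ p a v := by
  rcases ha with haA | hap
  · refine ⟨a, haA, by simp, ?_⟩
    rw [gromovProduct_self]
    exact_mod_cast hfar a haA
  · obtain ⟨v, hv, hav⟩ := hnear
    refine ⟨v, hv, hav, ?_⟩
    have hvp : (R : ℝ) ≤ Γ.dist v p := by exact_mod_cast hfar v hv
    have hav' : (Γ.dist a v : ℝ) ≤ R := by exact_mod_cast hav
    have hap' : (2 * R : ℝ) ≤ Γ.dist a p := by exact_mod_cast hap
    unfold gromovProduct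
    linarith

theorem IsGeodesic.exists_mem_mem_gromovProduct_le {c : ℕ → V} {N : ℕ} (hc : IsGeodesic Γ c N)
    (h : IsDeltaHyperbolic Γ δ) {A : Set V} (h0 : c 0 ∈ A) (hN : c N ∈ A) {R : ℕ}
    (hnear : ∀ t ≤ N, ∃ v ∈ A, Γ.dist (c t) v ≤ R) {t₀ : ℕ} (ht₀ : t₀ ≤ N)
    (hfar : ∀ v ∈ A, R ≤ Γ.dist v (c t₀)) :
    ∃ v ∈ A, ∃ w ∈ A, Γ.dist v w ≤ 6 * R ∧
      min (R : ℝ) (gromovProduct Γ (c t₀) v w) ≤ 2 * δ := by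
  obtain ⟨a, ha, haN, hat, hbefore⟩ : ∃ a ≤ t₀, a ≤ N ∧ t₀ ≤ a + 2 * R ∧
      (c a ∈ A ∨ 2 * R ≤ Γ.dist (c a) (c t₀)) := by
    rcases le_total t₀ (2 * R) with hle | hle
    · exact ⟨0, by omega, by omega, by omega, .inl h0⟩
    · exact ⟨t₀ - 2 * R, by omega, by omega, by omega, .inr (by
        rw [hc (by omega) ht₀]; omega)⟩
  obtain ⟨b, hb, hbN, hbt, hafter⟩ : ∃ b, t₀ ≤ b ∧ b ≤ N ∧ b ≤ t₀ + 2 * R ∧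
      (c b ∈ A ∨ 2 * R ≤ Γ.dist (c b) (c t₀)) := by
    rcases le_total N (t₀ + 2 * R) with hle | hle
    · exact ⟨N, ht₀, le_rfl, hle, .inl hN⟩
    · exact ⟨t₀ + 2 * R, by omega, hle, le_rfl, .inr (by
        rw [Γ.dist_comm, hc (by omega) hle]; omega)⟩
  obtain ⟨v, hv, hav, hRv⟩ := exists_mem_le_gromovProduct hfar (hnear a haN) hbefore
  obtain ⟨w, hw, hbw, hRw⟩ := exists_mem_le_gromovProduct hfar (hnear b hbN) hafter
  refine ⟨v, hv, w, hw, ?_, ?_⟩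
  · have hab := hc (ha.trans hb) hbN
    have hvw := h.connected.dist_triangle (u := v) (v := c a) (w := w)
    have haw := h.connected.dist_triangle (u := c a) (v := c b) (w := w)
    rw [Γ.dist_comm (u := v) (v := c a)] at hvw
    omega
  · have hab := hc.gromovProduct_eq_zero ha hb hbN
    rw [gromovProduct_comm] at hRw
    rw [min_le_iff]
    rcases h.le_or_le_or_le (c t₀) (c a) v w (c b) with hle | hle | hle <;> rw [hab] at hle
    · left; linarith
    · right; linarith
    · left; linarith

theorem exists_nat_covering_radius (Γ : SimpleGraph V) {A : Set V} (hA : A.Nonempty) (c : ℕ → V)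
    (N : ℕ) : ∃ R : ℕ, (∀ t ≤ N, ∃ v ∈ A, Γ.dist (c t) v ≤ R) ∧
      ∃ t ≤ N, ∀ v ∈ A, R ≤ Γ.dist v (c t) := by
  obtain ⟨t₀, ht₀, hmax⟩ := (Finset.Iic N).exists_max_image
    (fun t => sInf (Γ.dist (c t) '' A)) ⟨0, by simp⟩
  refine ⟨sInf (Γ.dist (c t₀) '' A), fun t ht => ?_, t₀, Finset.mem_Iic.1 ht₀, fun v hv => ?_⟩
  · obtain ⟨v, hv, hdist⟩ := Nat.sInf_mem (hA.image (Γ.dist (c t)))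
    exact ⟨v, hv, hdist.trans_le (hmax t (Finset.mem_Iic.2 ht))⟩
  · rw [Γ.dist_comm]
    exact Nat.sInf_le (Set.mem_image_of_mem _ hv)

theorem exists_bound_of_le_mul_clog {A : ℝ} (hA : 0 ≤ A) (B : ℝ) (M : ℕ) :
    ∃ D : ℝ, ∀ R : ℕ, (R : ℝ) ≤ A * Nat.clog 2 (M * R) + B → (R : ℝ) ≤ D := by
  have hlim : Tendsto
      (fun k : ℕ => 2 * (M * (A * ((k : ℝ) ^ 1 / 2 ^ k) + B * ((k : ℝ) ^ 0 / 2 ^ k)))) atTop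
      (nhds (2 * (M * (A * 0 + B * 0)))) :=
    (((tendsto_pow_const_div_const_pow_of_one_lt 1 one_lt_two).const_mul A).add
      ((tendsto_pow_const_div_const_pow_of_one_lt 0 one_lt_two).const_mul B)).const_mul _
        |>.const_mul _
  obtain ⟨k₀, hk₀⟩ := eventually_atTop.1 (hlim.eventually_lt_const (u := 1) (by norm_num))
  refine ⟨A * (k₀ + 1) + B, fun R hR => ?_⟩
  set k := Nat.clog 2 (M * R)
  suffices hkk₀ : k ≤ k₀ + 1 by
    have : (k : ℝ) ≤ k₀ + 1 := by exact_mod_cast hkk₀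
    nlinarith
  by_contra! hlt
  have hpow : (2 : ℝ) ^ k < 2 * (M * R) := by
    have : 2 ^ (k - 1) < M * R := Nat.pow_lt_of_lt_clog (by omega)
    rw [← Nat.sub_add_cancel (show 1 ≤ k by omega), pow_succ']
    exact_mod_cast Nat.mul_lt_mul_of_pos_left this two_pos
  have hkk := hk₀ k (by omega)
  rw [show 2 * (M * (A * ((k : ℝ) ^ 1 / 2 ^ k) + B * ((k : ℝ) ^ 0 / 2 ^ k)))
    = 2 * (M * (A * k + B)) / 2 ^ k by ring, div_lt_one (by positivity)] at hkk
  have : (M : ℝ) * R ≤ M * (A * k + B) := by gcongr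
  linarith

theorem IsDeltaHyperbolic.exists_forall_isGeodesic_dist_le (h : IsDeltaHyperbolic Γ δ) (L : ℕ) :
    ∃ D : ℝ, ∀ {z c : ℕ → V} {n N : ℕ}, IsQuasiGeodesic Γ L z n → IsGeodesic Γ c N →
      c 0 = z 0 → c N = z n → ∀ t ≤ N, ∃ i ≤ n, (Γ.dist (c t) (z i) : ℝ) ≤ D := by
  obtain ⟨D, hD⟩ := exists_bound_of_le_mul_clog h.nonneg (2 * δ + L) (L * 6)
  refine ⟨D, fun {z c n N} hz hc h0 hN => ?_⟩
  obtain ⟨R, hnear, t₀, ht₀, hfar⟩ :=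
    exists_nat_covering_radius Γ (A := z '' Set.Iic n) ⟨z 0, 0, n.zero_le, rfl⟩ c N
  suffices hR : (R : ℝ) ≤ D by
    intro t ht
    obtain ⟨_, ⟨i, hi, rfl⟩, hdist⟩ := hnear t ht
    exact ⟨i, hi, (Nat.cast_le.2 hdist).trans hR⟩
  obtain ⟨_, ⟨i, hi, rfl⟩, _, ⟨j, hj, rfl⟩, hij, hmin⟩ := hc.exists_mem_mem_gromovProduct_le h
    (A := z '' Set.Iic n) ⟨0, n.zero_le, h0.symm⟩ ⟨n, Set.self_mem_Iic, hN.symm⟩ hnear ht₀ hfar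
  have hclog : L * Γ.dist (z i) (z j) ≤ 2 ^ Nat.clog 2 (L * 6 * R) :=
    (by rw [mul_assoc]; gcongr : _ ≤ L * 6 * R).trans (Nat.le_pow_clog one_lt_two _)
  obtain ⟨m, hm, hdist⟩ := hz.exists_dist_le h (c t₀) hi hj hclog
  have hRm : (R : ℝ) ≤ Γ.dist (c t₀) (z m) := by
    rw [cast_dist_comm]
    exact_mod_cast hfar _ ⟨m, hm, rfl⟩
  have hδ := h.nonneg
  refine hD R ?_
  rcases min_le_iff.1 hmin with hle | hle
  · have : 0 ≤ δ * Nat.clog 2 (L * 6 * R) := by positivity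
    linarith [(Nat.cast_nonneg L : (0 : ℝ) ≤ L)]
  · linarith

theorem IsDeltaHyperbolic.exists_gromovProduct_quasiGeodesic_le (h : IsDeltaHyperbolic Γ δ)
    (L : ℕ) : ∃ E : ℝ, ∀ {z : ℕ → V} {n : ℕ}, IsQuasiGeodesic Γ L z n →
      ∀ m ≤ n, gromovProduct Γ (z m) (z 0) (z n) ≤ E := by
  obtain ⟨D, hD⟩ := h.exists_forall_isGeodesic_dist_le L
  refine ⟨D + L * (L * (2 * D + 1)), fun {z n} hz m hm => ?_⟩
  obtain ⟨c, hc0, hcN, hc⟩ := exists_isGeodesic h.connected (z 0) (z n)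
  have hnear := hD hz hc hc0 hcN
  have hD0 : 0 ≤ D := by
    obtain ⟨i, -, hi⟩ := hnear 0 (Nat.zero_le _)
    exact (Nat.cast_nonneg _).trans hi
  -- Somewhere along `c`, the nearby points of `z` pass from before `z m` to after it.
  obtain ⟨s, t, hst, hts, htN, ⟨i, him, hsi⟩, ⟨j, hmj, hjn, htj⟩⟩ :=
    exists_adjacent_of_forall_or (P := fun t => ∃ i ≤ m, (Γ.dist (c t) (z i) : ℝ) ≤ D)
      (N := Γ.dist (z 0) (z n)) (Q := fun t => ∃ j, m ≤ j ∧ j ≤ n ∧ (Γ.dist (c t) (z j) : ℝ) ≤ D)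
      ⟨0, m.zero_le, by simpa only [hc0, Γ.dist_self, Nat.cast_zero] using hD0⟩ ⟨n, hm, le_rfl, by
        simpa only [hcN, Γ.dist_self, Nat.cast_zero] using hD0⟩
      fun t ht => by
        obtain ⟨i, hi, hti⟩ := hnear t ht
        exact (le_total i m).imp (fun him => ⟨i, him, hti⟩) fun hmi => ⟨i, hmi, hi, hti⟩
  have hij : (Γ.dist (z i) (z j) : ℝ) ≤ 2 * D + 1 := by
    have hstep := hc.cast_dist_le_one hst hts htN
    have htri := cast_dist_triangle h.connected (z i) (c s) (z j)
    have htri' := cast_dist_triangle h.connected (c s) (c t) (z j)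
    rw [cast_dist_comm Γ (z i) (c s)] at htri
    linarith
  have him' : (Γ.dist (z i) (z m) : ℝ) ≤ L * (L * (2 * D + 1)) := by
    have : (Γ.dist (z i) (z m) : ℝ) ≤ L * (L * Γ.dist (z i) (z j)) := by
      exact_mod_cast (hz.dist_le him hm).trans
        (Nat.mul_le_mul_left L ((Nat.sub_le_sub_right hmj i).trans (hz.sub_le (him.trans hmj) hjn)))
    exact this.trans (by gcongr)
  have hbase := gromovProduct_le_add_dist_base h.connected (z m) (c s) (z 0) (z n)
  have hgeod := hc.gromovProduct_eq_zero s.zero_le (hst.trans htN) le_rfl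
  rw [hc0, hcN] at hgeod
  have htri := cast_dist_triangle h.connected (z m) (z i) (c s)
  rw [cast_dist_comm Γ (z i) (c s), cast_dist_comm Γ (z m) (z i)] at htri
  linarith

theorem IsGeodesic.exists_dist_le {c : ℕ → V} {N : ℕ} (hc : IsGeodesic Γ c N)
    (h : IsDeltaHyperbolic Γ δ) (p : V) :
    ∃ t ≤ N, (Γ.dist p (c t) : ℝ) ≤ 2 * gromovProduct Γ p (c 0) (c N) + 2 * δ := by
  have hδ := h.nonneg
  have hN := hc.cast_dist N.zero_le le_rfl
  have hp := cast_dist_comm Γ p (c N)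
  rw [Nat.cast_zero, sub_zero] at hN
  rcases le_total (Γ.dist (c 0) p) N with hle | hle
  · have h0 := hc.cast_dist (Nat.zero_le _) hle
    have h1 := hc.cast_dist hle le_rfl
    have h2 := cast_dist_comm Γ p (c (Γ.dist (c 0) p))
    have htri := cast_dist_triangle h.connected (c 0) p (c N)
    rw [Nat.cast_zero, sub_zero] at h0
    refine ⟨_, hle, ?_⟩
    rcases h.le_or_le p (c 0) (c (Γ.dist (c 0) p)) (c N) with h3 | h3 <;>
    · unfold gromovProduct at h3 ⊢
      linarith
  · have := cast_dist_triangle h.connected p (c 0) (c N)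
    have : (N : ℝ) ≤ Γ.dist (c 0) p := by exact_mod_cast hle
    refine ⟨N, le_rfl, ?_⟩
    unfold gromovProduct
    linarith

theorem isDeltaHyperbolic_of_forall_isGeodesic (hΓ : Γ.Connected) {C : ℝ}
    (hthin : ∀ {c : ℕ → V} {n : ℕ}, IsGeodesic Γ c n → ∀ t ≤ n, ∀ y,
      gromovProduct Γ (c t) (c 0) y ≤ C ∨ gromovProduct Γ (c t) y (c n) ≤ C) :
    IsDeltaHyperbolic Γ (3 * C + 1) := by
  refine ⟨hΓ, fun w x y z => ?_⟩
  have hC : 0 ≤ C := by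
    rcases hthin (isGeodesic_zero fun _ => w) 0 le_rfl w with hle | hle <;>
      exact (gromovProduct_nonneg hΓ _ _ _).trans hle
  obtain ⟨c, hc0, hcN, hc⟩ := exists_isGeodesic hΓ x z
  have hthin' := hthin hc
  rw [hc0, hcN] at hthin'
  obtain ⟨s, t, hst, hts, htN, hs, ht⟩ := exists_adjacent_of_forall_or
    (P := fun t => gromovProduct Γ (c t) x w ≤ C) (Q := fun t => gromovProduct Γ (c t) w z ≤ C)
    (by simpa only [hc0, gromovProduct_base_left]) (by
      simpa only [hcN, gromovProduct_comm z w, gromovProduct_base_left]) fun t ht => hthin' t ht w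
  have hsN := hst.trans htN
  have hw : (Γ.dist w (c s) : ℝ) ≤ gromovProduct Γ w x z + 2 * C + 1 := by
    have hstep := hc.cast_dist_le_one hst hts htN
    have hbase := gromovProduct_le_add_dist_base hΓ (c s) (c t) w z
    have hgeod := hc.gromovProduct_eq_zero s.zero_le hsN le_rfl
    have hcomm := cast_dist_comm Γ w
    rw [hc0, hcN] at hgeod
    have := hcomm x
    have := hcomm z
    unfold gromovProduct at *
    linarith
  rcases hthin' s hsN y with hxy | hyz
  · have := gromovProduct_le_add_dist_base hΓ w (c s) x y
    have := min_le_left (gromovProduct Γ w x y) (gromovProduct Γ w y z)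
    linarith
  · have := gromovProduct_le_add_dist_base hΓ w (c s) y z
    have := min_le_right (gromovProduct Γ w x y) (gromovProduct Γ w y z)
    linarith

variable {Γ₀ : SimpleGraph V} {L : ℕ}

theorem IsGeodesic.isQuasiGeodesic (hL : ∀ x y, Γ₀.dist x y ≤ L * Γ.dist x y)
    (hL' : ∀ x y, Γ.dist x y ≤ L * Γ₀.dist x y) {c : ℕ → V} {n : ℕ} (hc : IsGeodesic Γ c n) :
    IsQuasiGeodesic Γ₀ L c n where
  dist_le i j hij hj := by simpa only [hc hij hj] using hL (c i) (c j)
  sub_le i j hij hj := by simpa only [hc hij hj] using hL' (c i) (c j)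

theorem IsDeltaHyperbolic.exists_gromovProduct_le_of_bilipschitz (h : IsDeltaHyperbolic Γ₀ δ)
    (hΓ : Γ.Connected) (hL : ∀ x y, Γ₀.dist x y ≤ L * Γ.dist x y)
    (hL' : ∀ x y, Γ.dist x y ≤ L * Γ₀.dist x y) :
    ∃ C : ℝ, ∀ p x y, gromovProduct Γ p x y ≤ L * (2 * gromovProduct Γ₀ p x y + C) := by
  obtain ⟨D, hD⟩ := h.exists_forall_isGeodesic_dist_le L
  refine ⟨2 * δ + D, fun p x y => ?_⟩
  obtain ⟨z, hz0, hzn, hz⟩ := exists_isGeodesic hΓ x y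
  obtain ⟨c, hc0, hcN, hc⟩ := exists_isGeodesic h.connected x y
  obtain ⟨t, ht, hpt⟩ := hc.exists_dist_le h p
  obtain ⟨i, hi, hti⟩ := hD (hz.isQuasiGeodesic hL hL') hc (hc0.trans hz0.symm)
    (hcN.trans hzn.symm) t ht
  have hgeod := hz.gromovProduct_eq_zero i.zero_le hi le_rfl
  rw [hz0, hzn] at hgeod
  rw [hc0, hcN] at hpt
  calc gromovProduct Γ p x y
      ≤ gromovProduct Γ (z i) x y + Γ.dist p (z i) := gromovProduct_le_add_dist_base hΓ _ _ _ _
    _ ≤ L * Γ₀.dist p (z i) := by rw [hgeod, zero_add]; exact_mod_cast hL' p (z i)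
    _ ≤ L * (2 * gromovProduct Γ₀ p x y + (2 * δ + D)) := by
        have := cast_dist_triangle h.connected p (c t) (z i)
        gcongr
        linarith

theorem IsGromovHyperbolic.of_bilipschitz (h : IsGromovHyperbolic Γ₀) (hΓ : Γ.Connected)
    (hL : ∀ x y, Γ₀.dist x y ≤ L * Γ.dist x y) (hL' : ∀ x y, Γ.dist x y ≤ L * Γ₀.dist x y) :
    IsGromovHyperbolic Γ := by
  obtain ⟨δ, h⟩ := isGromovHyperbolic_iff_exists.1 h
  obtain ⟨E, hE⟩ := h.exists_gromovProduct_quasiGeodesic_le L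
  obtain ⟨C, hC⟩ := h.exists_gromovProduct_le_of_bilipschitz hΓ hL hL'
  have hle : ∀ {p x y}, gromovProduct Γ₀ p x y ≤ E + δ →
      gromovProduct Γ p x y ≤ L * (2 * (E + δ) + C) := fun {p x y} hp =>
    (hC p x y).trans (by gcongr)
  refine isGromovHyperbolic_iff_exists.2 ⟨_, isDeltaHyperbolic_of_forall_isGeodesic hΓ
    (C := L * (2 * (E + δ) + C)) fun {c n} hc t ht y => ?_⟩
  have hct := hE (hc.isQuasiGeodesic hL hL') t ht
  exact (h.le_or_le (c t) (c 0) y (c n)).imp (fun hxy => hle (by linarith)) fun hyz =>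
    hle (by linarith)

theorem dist_le_mul_of_adj (h₀ : Γ₀.Connected) (hΓ : Γ.Connected)
    (hadj : ∀ x y, Γ.Adj x y → Γ₀.dist x y ≤ L) (x y : V) : Γ₀.dist x y ≤ L * Γ.dist x y := by
  obtain ⟨p, hp⟩ := hΓ.exists_walk_length_eq_dist x y
  rw [← hp]
  clear hp
  induction p with
  | nil => simp
  | @cons u v w huv p ih =>
    calc Γ₀.dist u w ≤ Γ₀.dist u v + Γ₀.dist v w := h₀.dist_triangle
      _ ≤ L + L * p.length := add_le_add (hadj u v huv) ih
      _ = L * (SimpleGraph.Walk.cons huv p).length := by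
        rw [SimpleGraph.Walk.length_cons]; ring

end Hyperbolic

section Cayley

open SimpleGraph

variable {H : Type*} [Group H] {S : Set H}

theorem mulCayley_connected (hgen : Subgroup.closure S = ⊤) : (mulCayley S).Connected := by
  have hreach : ∀ x y : H, x⁻¹ * y ∈ S ∨ y⁻¹ * x ∈ S → (mulCayley S).Reachable x y := by
    intro x y hxy
    by_cases heq : x = y
    · exact heq ▸ .refl x
    · exact ((mulCayley_adj S x y).2 ⟨heq, hxy⟩).reachable
  have hone : ∀ x : H, (mulCayley S).Reachable 1 x := fun x => by
    induction hgen ▸ Subgroup.mem_top x using Subgroup.closure_induction_right with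
    | one => exact .refl _
    | mul_right x _ s hs ih => exact ih.trans (hreach x (x * s) (.inl (by simpa using hs)))
    | mul_inv_cancel x _ s hs ih =>
      exact ih.trans (hreach x (x * s⁻¹) (.inr (by simpa using hs)))
  exact ⟨fun x y => (hone x).symm.trans (hone y)⟩

theorem dist_mul_mul_left (g x y : H) :
    (mulCayley S).dist (g * x) (g * y) = (mulCayley S).dist x y := by
  have hle : ∀ g x y : H, (mulCayley S).edist (g * x) (g * y) ≤ (mulCayley S).edist x y := by
    intro g x y
    let f : mulCayley S →g mulCayley S := ⟨(g * ·), mulCayley_adj_mul_iff_right.2⟩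
    exact le_iInf fun p => (edist_le (p.map f)).trans_eq (by rw [Walk.length_map])
  refine congrArg ENat.toNat (le_antisymm (hle g x y) ?_)
  simpa only [inv_mul_cancel_left] using hle g⁻¹ (g * x) (g * y)

theorem dist_mul_left_self (g x : H) : (mulCayley S).dist (g * x) g = (mulCayley S).dist x 1 := by
  simpa only [mul_one] using dist_mul_mul_left g x 1

theorem dist_inv_left (g x : H) : (mulCayley S).dist g⁻¹ x = (mulCayley S).dist (g * x) 1 := by
  rw [← dist_mul_mul_left g, mul_inv_cancel, dist_comm]

theorem dist_inv_one (g : H) : (mulCayley S).dist g⁻¹ 1 = (mulCayley S).dist g 1 := by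
  rw [dist_inv_left, mul_one]

theorem dist_one_le_dist_mul_add (hΓ : (mulCayley S).Connected) (g x : H) :
    (mulCayley S).dist x 1 ≤ (mulCayley S).dist (g * x) 1 + (mulCayley S).dist g 1 := by
  rw [← dist_inv_left, ← dist_inv_one g, dist_comm (u := g⁻¹) (v := x)]
  exact hΓ.dist_triangle

theorem finite_setOf_dist_mulCayley_le (hΓ : (mulCayley S).Connected) (hfin : S.Finite) (r : ℕ) :
    {x | (mulCayley S).dist x 1 ≤ r}.Finite := by
  induction r with
  | zero =>
    refine (Set.finite_singleton 1).subset fun x hx => ?_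
    simpa [hΓ.dist_eq_zero_iff] using hx
  | succ r ih =>
    refine (ih.union (ih.image2 (· * ·) (hfin.union hfin.inv))).subset fun x hx => ?_
    rcases Nat.of_le_succ hx with hle | heq
    · exact .inl hle
    obtain ⟨c, h0, hn, hc⟩ := exists_isGeodesic hΓ 1 x
    rw [dist_comm, heq] at hn hc
    have hcr : (mulCayley S).dist (c r) 1 = r := by
      rw [← h0, dist_comm, hc r.zero_le r.le_succ, Nat.sub_zero]
    have hadj : (mulCayley S).Adj (c r) x := by
      rw [← dist_eq_one_iff_adj, ← hn, hc r.le_succ le_rfl]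
      exact Nat.add_sub_cancel_left r 1
    refine .inr ⟨c r, hcr.le, (c r)⁻¹ * x, ?_, mul_inv_cancel_left _ _⟩
    exact ((mulCayley_adj S _ _).1 hadj).2.imp id fun hs => by simpa using hs

theorem exists_mem_lt_dist (hΓ : (mulCayley S).Connected) (hfin : S.Finite) {A : Set H}
    (hA : A.Infinite) (r : ℕ) : ∃ a ∈ A, r < (mulCayley S).dist a 1 := by
  obtain ⟨a, ha, har⟩ := (hA.sdiff (finite_setOf_dist_mulCayley_le hΓ hfin r)).nonempty
  exact ⟨a, ha, not_le.1 har⟩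

theorem exists_dist_mulCayley_le_mul {S₀ : Set H} (h₀ : (mulCayley S₀).Connected)
    (hΓ : (mulCayley S).Connected) (hfin : S.Finite) :
    ∃ L : ℕ, ∀ x y, (mulCayley S₀).dist x y ≤ L * (mulCayley S).dist x y := by
  obtain ⟨L, hL⟩ := (hfin.image fun s => (mulCayley S₀).dist s 1).bddAbove
  replace hL : ∀ x y : H, x⁻¹ * y ∈ S → (mulCayley S₀).dist x y ≤ L := by
    intro x y hxy
    rw [← dist_mul_mul_left x⁻¹, inv_mul_cancel, dist_comm]
    exact hL (Set.mem_image_of_mem _ hxy)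
  refine ⟨L, dist_le_mul_of_adj h₀ hΓ fun x y hxy => ?_⟩
  rcases ((mulCayley_adj S x y).1 hxy).2 with hs | hs
  · exact hL x y hs
  · rw [dist_comm]
    exact hL y x hs

theorem IsWordHyperbolic.isGromovHyperbolic (hH : IsWordHyperbolic H) (hfin : S.Finite)
    (hgen : Subgroup.closure S = ⊤) : IsGromovHyperbolic (mulCayley S) := by
  obtain ⟨S₀, hfin₀, -, h⟩ := hH
  have hΓ := mulCayley_connected hgen
  obtain ⟨L, hL⟩ := exists_dist_mulCayley_le_mul h.1 hΓ hfin
  obtain ⟨L', hL'⟩ := exists_dist_mulCayley_le_mul hΓ h.1 hfin₀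
  exact h.of_bilipschitz hΓ (L := max L L')
    (fun x y => (hL x y).trans (Nat.mul_le_mul_right _ (le_max_left _ _)))
    (fun x y => (hL' x y).trans (Nat.mul_le_mul_right _ (le_max_right _ _)))

theorem dist_mul_one (g x : H) : ((mulCayley S).dist (g * x) 1 : ℝ) =
    (mulCayley S).dist g 1 + (mulCayley S).dist x 1 - 2 * gromovProduct (mulCayley S) 1 g⁻¹ x := by
  unfold gromovProduct
  rw [dist_inv_one, dist_inv_left]
  ring

theorem gromovProduct_mul_left_self (g x : H) : gromovProduct (mulCayley S) 1 (g * x) g =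
    (mulCayley S).dist g 1 - gromovProduct (mulCayley S) 1 g⁻¹ x := by
  unfold gromovProduct
  rw [dist_mul_left_self, dist_inv_one, dist_inv_left]
  ring

end Cayley

section LongSquare

open SimpleGraph

variable {H : Type*} [Group H] {S : Set H} {δ : ℝ} {q : H}

/-- The square of `q` is longer than `q` by more than `3 * δ`. In a `δ`-hyperbolic Cayley graph
this local condition forces `q` to be loxodromic: the powers of `q` follow a quasi-geodesic. -/
def HasLongSquare (S : Set H) (δ : ℝ) (q : H) : Prop :=
  (mulCayley S).dist q 1 + 3 * δ < (mulCayley S).dist (q ^ 2) 1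

theorem hasLongSquare_iff : HasLongSquare S δ q ↔
    2 * gromovProduct (mulCayley S) 1 q q⁻¹ + 3 * δ < (mulCayley S).dist q 1 := by
  rw [HasLongSquare, sq, dist_mul_one, gromovProduct_comm 1 q⁻¹]
  constructor <;> intro hq <;> linarith

theorem hasLongSquare_inv : HasLongSquare S δ q⁻¹ ↔ HasLongSquare S δ q := by
  rw [hasLongSquare_iff, hasLongSquare_iff, inv_inv, gromovProduct_comm, dist_inv_one]

namespace HasLongSquare

theorem gromovProduct_pow_inv_le (hq : HasLongSquare S δ q) (h : IsDeltaHyperbolic (mulCayley S) δ)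
    (n : ℕ) : gromovProduct (mulCayley S) 1 (q ^ n) q⁻¹ ≤
      gromovProduct (mulCayley S) 1 q q⁻¹ + δ := by
  have hδ := h.nonneg
  have hnonneg := gromovProduct_nonneg h.connected 1 q q⁻¹
  rw [hasLongSquare_iff] at hq
  induction n with
  | zero =>
    rw [pow_zero, gromovProduct_base_left]
    positivity
  | succ n ih =>
    refine (h.le_or_le 1 q (q ^ (n + 1)) q⁻¹).resolve_left ?_
    rw [gromovProduct_comm, pow_succ', gromovProduct_mul_left_self, gromovProduct_comm 1 q⁻¹]
    linarith

theorem le_gromovProduct_pow_succ (hq : HasLongSquare S δ q)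
    (h : IsDeltaHyperbolic (mulCayley S) δ) (n : ℕ) :
    (mulCayley S).dist q 1 - gromovProduct (mulCayley S) 1 q q⁻¹ - δ ≤
      gromovProduct (mulCayley S) 1 (q ^ (n + 1)) q := by
  rw [pow_succ', gromovProduct_mul_left_self, gromovProduct_comm 1 q⁻¹]
  linarith [hq.gromovProduct_pow_inv_le h n]

theorem gromovProduct_pow_inv_pow_le (hq : HasLongSquare S δ q)
    (h : IsDeltaHyperbolic (mulCayley S) δ) (m n : ℕ) :
    gromovProduct (mulCayley S) 1 (q ^ m) (q⁻¹ ^ n) ≤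
      gromovProduct (mulCayley S) 1 q q⁻¹ + 2 * δ := by
  have hδ := h.nonneg
  have hnonneg := gromovProduct_nonneg h.connected 1 q q⁻¹
  rcases n with _ | n
  · rw [pow_zero, gromovProduct_comm, gromovProduct_base_left]
    positivity
  · have hm := hq.gromovProduct_pow_inv_le h m
    have hn := (hasLongSquare_inv.2 hq).le_gromovProduct_pow_succ h n
    rw [inv_inv, dist_inv_one, gromovProduct_comm 1 q⁻¹ q] at hn
    rw [hasLongSquare_iff] at hq
    rcases h.le_or_le 1 (q ^ m) (q⁻¹ ^ (n + 1)) q⁻¹ with hle | hle <;> linarith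

theorem not_isOfFinOrder (hq : HasLongSquare S δ q) (h : IsDeltaHyperbolic (mulCayley S) δ) :
    ¬IsOfFinOrder q := by
  rw [isOfFinOrder_iff_pow_eq_one]
  rintro ⟨n, hn, hqn⟩
  obtain ⟨n, rfl⟩ := Nat.exists_eq_add_one_of_ne_zero hn.ne'
  have hle := hq.le_gromovProduct_pow_succ h n
  have hδ := h.nonneg
  have hnonneg := gromovProduct_nonneg h.connected 1 q q⁻¹
  rw [hqn, gromovProduct_base_left] at hle
  rw [hasLongSquare_iff] at hq
  linarith

end HasLongSquare

-- Otherwise `q` and `p` together with their inverses behave like a free basis, and `q * p` has a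
-- long square.
theorem half_min_dist_sub_le_gromovProduct (h : IsDeltaHyperbolic (mulCayley S) δ) {p : H}
    (hq : ¬HasLongSquare S δ q) (hp : ¬HasLongSquare S δ p) (hqp : ¬HasLongSquare S δ (q * p)) :
    min ((mulCayley S).dist q 1 : ℝ) ((mulCayley S).dist p 1) / 2 - 3 * δ ≤
      gromovProduct (mulCayley S) 1 q p := by
  have hδ := h.nonneg
  have hminq := min_le_left ((mulCayley S).dist q 1 : ℝ) ((mulCayley S).dist p 1)
  have hminp := min_le_right ((mulCayley S).dist q 1 : ℝ) ((mulCayley S).dist p 1)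
  rw [hasLongSquare_iff, not_lt] at hq hp hqp
  by_contra! hlt
  have hqinv : gromovProduct (mulCayley S) 1 q⁻¹ p ≤ gromovProduct (mulCayley S) 1 q p + δ :=
    (h.le_or_le 1 q q⁻¹ p).resolve_left (by linarith)
  have hpinv : gromovProduct (mulCayley S) 1 q p⁻¹ ≤ gromovProduct (mulCayley S) 1 q p + δ :=
    (h.le_or_le 1 q p⁻¹ p).resolve_right (by rw [gromovProduct_comm]; linarith)
  have hqp_q := gromovProduct_mul_left_self (S := S) q p
  have hqp_p := gromovProduct_mul_left_self (S := S) p⁻¹ q⁻¹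
  rw [← mul_inv_rev, inv_inv, dist_inv_one, gromovProduct_comm 1 p] at hqp_p
  have hfold : gromovProduct (mulCayley S) 1 (q * p) (q * p)⁻¹ ≤
      gromovProduct (mulCayley S) 1 q p + 3 * δ := by
    have := (h.le_or_le 1 q (q * p) p⁻¹).resolve_left (by
      rw [gromovProduct_comm 1 q]
      linarith)
    have := (h.le_or_le 1 (q * p) (q * p)⁻¹ p⁻¹).resolve_right (by linarith)
    linarith
  have := dist_mul_one (S := S) q p
  linarith

variable {Q : Subgroup H} {p x : H}

theorem abs_dist_mul_sub_dist_le (h : IsDeltaHyperbolic (mulCayley S) δ)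
    (hQ : ∀ q ∈ Q, ¬HasLongSquare S δ q) (hq : q ∈ Q) (hp : p ∈ Q)
    (hqp : 2 * (mulCayley S).dist q 1 ≤ (mulCayley S).dist p 1) :
    |((mulCayley S).dist (q * p) 1 : ℝ) - (mulCayley S).dist p 1| ≤ 6 * δ := by
  have hle_mul : (mulCayley S).dist q 1 ≤ (mulCayley S).dist (q * p) 1 := by
    have := dist_one_le_dist_mul_add h.connected q p
    omega
  have hinv := half_min_dist_sub_le_gromovProduct h (hQ _ (inv_mem hq)) (hQ p hp)
    (hQ _ (mul_mem (inv_mem hq) hp))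
  have hmul := half_min_dist_sub_le_gromovProduct h (hQ _ (mul_mem hq hp)) (hQ q hq)
    (hQ _ (mul_mem (mul_mem hq hp) hq))
  rw [dist_inv_one, min_eq_left (Nat.cast_le.2 (by omega))] at hinv
  rw [gromovProduct_mul_left_self, min_eq_right (Nat.cast_le.2 hle_mul)] at hmul
  rw [dist_mul_one, abs_le]
  constructor <;> linarith

theorem abs_dist_mul_sub_dist_le_of_gromovProduct_eq (h : IsDeltaHyperbolic (mulCayley S) δ)
    (hQ : ∀ q ∈ Q, ¬HasLongSquare S δ q) (hq : q ∈ Q) (hp : p ∈ Q)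
    (hqp : 2 * (mulCayley S).dist q 1 ≤ (mulCayley S).dist p 1)
    (hxp : gromovProduct (mulCayley S) 1 x p = (mulCayley S).dist x 1)
    (hqx : (mulCayley S).dist q 1 + 4 * δ < (mulCayley S).dist x 1) :
    |((mulCayley S).dist (q * x) 1 : ℝ) - (mulCayley S).dist x 1| ≤ 8 * δ := by
  have hδ := h.nonneg
  have : (0 : ℝ) ≤ (mulCayley S).dist q 1 := by positivity
  obtain ⟨hlow, hupp⟩ := abs_le.1 (abs_dist_mul_sub_dist_le h hQ hq hp hqp)
  rw [dist_mul_one] at hlow hupp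
  have hpx := gromovProduct_comm (Γ := mulCayley S) 1 p x
  rw [dist_mul_one, abs_le]
  constructor
  · rcases h.le_or_le 1 q⁻¹ x p with hle | hle <;> linarith
  · rcases h.le_or_le 1 q⁻¹ p x with hle | hle <;> linarith

theorem dist_mul_le_of_gromovProduct_eq (h : IsDeltaHyperbolic (mulCayley S) δ)
    (hQ : ∀ q ∈ Q, ¬HasLongSquare S δ q) (hq : q ∈ Q) (hp : p ∈ Q)
    (hxp : gromovProduct (mulCayley S) 1 x p = (mulCayley S).dist x 1)
    (hqx : (mulCayley S).dist q 1 + 4 * δ < (mulCayley S).dist x 1)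
    (hqxp : 2 * (mulCayley S).dist x 1 + (mulCayley S).dist q 1 + 6 * δ ≤
      (mulCayley S).dist p 1) :
    ((mulCayley S).dist x (q * x) : ℝ) ≤ 26 * δ := by
  have hδ := h.nonneg
  have hqp : 2 * (mulCayley S).dist q 1 ≤ (mulCayley S).dist p 1 := by
    have : (2 * (mulCayley S).dist q 1 : ℝ) ≤ (mulCayley S).dist p 1 := by linarith
    exact_mod_cast this
  obtain ⟨hqp_low, -⟩ := abs_le.1 (abs_dist_mul_sub_dist_le h hQ hq hp hqp)
  obtain ⟨hqx_low, hqx_upp⟩ :=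
    abs_le.1 (abs_dist_mul_sub_dist_le_of_gromovProduct_eq h hQ hq hp hqp hxp hqx)
  have hp_qp : ((mulCayley S).dist x 1 : ℝ) ≤ gromovProduct (mulCayley S) 1 p (q * p) := by
    refine le_trans ?_ (half_min_dist_sub_le_gromovProduct h (hQ p hp) (hQ _ (mul_mem hq hp))
      (hQ _ (mul_mem hp (mul_mem hq hp))))
    have : ((mulCayley S).dist p 1 - (mulCayley S).dist q 1 : ℝ) ≤
        min ((mulCayley S).dist p 1 : ℝ) ((mulCayley S).dist (q * p) 1) := by
      refine le_min (sub_le_self _ (Nat.cast_nonneg _)) (sub_le_iff_le_add.2 ?_)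
      exact_mod_cast dist_one_le_dist_mul_add h.connected q p
    linarith
  have hqp_qx : ((mulCayley S).dist x 1 : ℝ) - 7 * δ ≤
      gromovProduct (mulCayley S) 1 (q * p) (q * x) := by
    unfold gromovProduct at hxp ⊢
    rw [dist_mul_mul_left, cast_dist_comm _ p]
    linarith
  have hx_qx : ((mulCayley S).dist x 1 : ℝ) - 9 * δ ≤ gromovProduct (mulCayley S) 1 x (q * x) := by
    rcases h.le_or_le_or_le 1 x p (q * p) (q * x) with hle | hle | hle <;> linarith
  unfold gromovProduct at hx_qx
  linarith

theorem exists_forall_mem_dist_mul_le (h : IsDeltaHyperbolic (mulCayley S) δ) (hfin : S.Finite)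
    (hinf : (Q : Set H).Infinite) (hQ : ∀ q ∈ Q, ¬HasLongSquare S δ q) {T : Set H}
    (hT : T.Finite) (hTQ : T ⊆ Q) :
    ∃ x, ∀ q ∈ T, ((mulCayley S).dist x (q * x) : ℝ) ≤ 26 * δ := by
  obtain ⟨M, hM⟩ := (hT.image fun q => (mulCayley S).dist q 1).bddAbove
  obtain ⟨D, hD⟩ := exists_nat_gt (4 * δ)
  obtain ⟨p, hp, hlt⟩ := exists_mem_lt_dist h.connected hfin hinf (2 * (M + D) + M + 2 * D)
  obtain ⟨x, hx, hxp⟩ := exists_dist_eq_gromovProduct_eq h.connected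
    (show M + D ≤ (mulCayley S).dist p 1 by omega)
  refine ⟨x, fun q hq => ?_⟩
  have hqM : ((mulCayley S).dist q 1 : ℝ) ≤ M := by exact_mod_cast hM (Set.mem_image_of_mem _ hq)
  have hlt' : (2 * (M + D) + M + 2 * D : ℝ) < (mulCayley S).dist p 1 := by exact_mod_cast hlt
  have hδ := h.nonneg
  refine dist_mul_le_of_gromovProduct_eq h hQ (hTQ hq) hp (hx ▸ hxp) ?_ ?_ <;>
  · rw [hx, Nat.cast_add]
    linarith

theorem exists_hasLongSquare (h : IsDeltaHyperbolic (mulCayley S) δ) (hfin : S.Finite)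
    (hinf : (Q : Set H).Infinite) : ∃ q ∈ Q, HasLongSquare S δ q := by
  by_contra! hQ
  have hball := finite_setOf_dist_mulCayley_le h.connected hfin ⌊26 * δ⌋₊
  obtain ⟨T, hTQ, hT⟩ := hinf.exists_subset_card_eq (hball.toFinset.card + 1)
  obtain ⟨x, hx⟩ := exists_forall_mem_dist_mul_le h hfin hinf hQ T.finite_toSet hTQ
  have hmaps : Set.MapsTo (fun q => x⁻¹ * (q * x)) T hball.toFinset := by
    intro q hq
    rw [hball.coe_toFinset]
    refine Nat.le_floor ?_
    rw [dist_comm, ← inv_mul_cancel x, dist_mul_mul_left]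
    exact hx q hq
  have hcard := Finset.card_le_card_of_injOn _ hmaps fun a _ b _ hab => by simpa using hab
  omega

theorem IsWordHyperbolic.exists_not_isOfFinOrder (hH : IsWordHyperbolic H)
    (hinf : (Q : Set H).Infinite) : ∃ q ∈ Q, ¬IsOfFinOrder q := by
  obtain ⟨S, hfin, -, h⟩ := hH
  obtain ⟨δ, h⟩ := isGromovHyperbolic_iff_exists.1 h
  obtain ⟨q, hqQ, hq⟩ := exists_hasLongSquare h hfin hinf
  exact ⟨q, hqQ, hq.not_isOfFinOrder h⟩

end LongSquare

section LimitSet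

variable {V : Type*} {Γ : SimpleGraph V} {δ B : ℝ} {w : V}

theorem GromovDiverge.of_le_gromovProduct (h : IsDeltaHyperbolic Γ δ) {x y : ℕ → V}
    (hx : GromovDiverge Γ w x x) (hxy : ∀ n, Γ.dist (x n) w - B ≤ gromovProduct Γ w (x n) (y n)) :
    GromovDiverge Γ w x y := by
  refine tendsto_atTop.2 fun b => ?_
  have hx_large := tendsto_atTop.1 hx (b + δ)
  have hdist_large : ∀ᶠ p : ℕ × ℕ in atTop, b + δ + B ≤ Γ.dist (x p.2) w := by
    have hdiag : Tendsto (fun p : ℕ × ℕ => (p.2, p.2)) atTop atTop := by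
      rw [← prod_atTop_atTop_eq]
      exact tendsto_snd.prodMk tendsto_snd
    simpa only [gromovProduct_self] using hdiag.eventually (tendsto_atTop.1 hx (b + δ + B))
  filter_upwards [hx_large, hdist_large] with p hp hdist
  have hle := hxy p.2
  rcases h.le_or_le w (x p.1) (x p.2) (y p.2) with h' | h' <;> linarith

theorem IsDeltaHyperbolic.limitSet_eq_univ (h : IsDeltaHyperbolic Γ δ) {A : Set V}
    (hA : ∀ v, ∃ a ∈ A, Γ.dist v w - B ≤ gromovProduct Γ w v a) : limitSet Γ w A = Set.univ := by
  choose a haA ha using hA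
  refine Set.eq_univ_of_forall fun ξ => ?_
  induction ξ using Quot.ind with
  | mk x =>
    have hxa : GromovDiverge Γ w x.1 fun n => a (x.1 n) := x.2.of_le_gromovProduct h fun n => ha _
    exact ⟨⟨_, hxa.symm.trans (isGromovHyperbolic_iff_exists.2 ⟨δ, h⟩) hxa⟩, fun n => haA _,
      Quot.sound hxa.symm⟩

end LimitSet

section QuasiNormal

open SimpleGraph
open scoped Pointwise

variable {H : Type*} [Group H] {Q : Subgroup H} {S : Set H} {δ : ℝ} {q : H}

theorem IsQuasiNormal.exists_conj_pow_mem (hQ : IsQuasiNormal Q) (g : H) (hq : q ∈ Q) :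
    ∃ n, 0 < n ∧ g * q ^ n * g⁻¹ ∈ Q := by
  have hg : g ∈ Subgroup.Commensurable.commensurator Q := hQ ▸ Subgroup.mem_top g
  have hmem : g * q * g⁻¹ ∈ ConjAct.toConjAct g • Q :=
    Subgroup.smul_mem_pointwise_smul q (ConjAct.toConjAct g) Q hq
  obtain ⟨n, hn, -, hpow⟩ := Subgroup.exists_pow_mem_of_relIndex_ne_zero
    ((Subgroup.Commensurable.commensurator_mem_iff Q g).1 hg).2 hmem
  exact ⟨n, hn, conj_pow (a := g) ▸ hpow.1⟩

theorem sub_le_gromovProduct_conj (h : IsDeltaHyperbolic (mulCayley S) δ) {g r : H} {K : ℝ}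
    (hgr : gromovProduct (mulCayley S) 1 g⁻¹ r ≤ K)
    (hlen : 3 * (mulCayley S).dist g 1 ≤ (mulCayley S).dist r 1) :
    (mulCayley S).dist g 1 - (K + δ) ≤ gromovProduct (mulCayley S) 1 g (g * r * g⁻¹) := by
  have hK := (gromovProduct_nonneg h.connected 1 g⁻¹ r).trans hgr
  have hg_gr := gromovProduct_mul_left_self (S := S) g r
  have hgr_conj : ((mulCayley S).dist g 1 : ℝ) ≤
      gromovProduct (mulCayley S) 1 (g * r) (g * r * g⁻¹) := by
    have hstep : (mulCayley S).dist (g * r) (g * r * g⁻¹) = (mulCayley S).dist g 1 := by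
      rw [dist_comm, dist_mul_left_self, dist_inv_one]
    have hlen' : (3 * (mulCayley S).dist g 1 : ℝ) ≤ (mulCayley S).dist r 1 := by
      exact_mod_cast hlen
    have hgr_len : ((mulCayley S).dist r 1 : ℝ) ≤
        (mulCayley S).dist (g * r) 1 + (mulCayley S).dist g 1 := by
      exact_mod_cast dist_one_le_dist_mul_add h.connected g r
    have htri := cast_dist_triangle h.connected (g * r) (g * r * g⁻¹) 1
    rw [hstep] at htri
    rw [gromovProduct, hstep]
    linarith
  rw [gromovProduct_comm] at hg_gr
  rcases h.le_or_le 1 g (g * r) (g * r * g⁻¹) with hle | hle <;> linarith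

theorem HasLongSquare.exists_conj_mem (hq : HasLongSquare S δ q)
    (h : IsDeltaHyperbolic (mulCayley S) δ) (hfin : S.Finite) {g : H} {n : ℕ} (hn : 0 < n)
    (hmem : g * q ^ n * g⁻¹ ∈ Q) (N : ℕ) :
    ∃ r, g * r * g⁻¹ ∈ Q ∧ N ≤ (mulCayley S).dist r 1 ∧
      gromovProduct (mulCayley S) 1 g⁻¹ r ≤ gromovProduct (mulCayley S) 1 q q⁻¹ + 3 * δ := by
  have hinf : (Submonoid.powers (q ^ n) : Set H).Infinite :=
    infinite_powers.2 (mt (isOfFinOrder_pow.1 · |>.resolve_right hn.ne') (hq.not_isOfFinOrder h))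
  obtain ⟨_, ⟨k, rfl⟩, hk⟩ := exists_mem_lt_dist h.connected hfin hinf N
  have hmemk : g * (q ^ n) ^ k * g⁻¹ ∈ Q := conj_pow (a := g) ▸ pow_mem hmem k
  simp only [← pow_mul] at hk hmemk
  have hsep := hq.gromovProduct_pow_inv_pow_le h (n * k) (n * k)
  rcases h.le_or_le 1 (q ^ (n * k)) g⁻¹ (q⁻¹ ^ (n * k)) with hle | hle
  · exact ⟨_, hmemk, hk.le, by rw [gromovProduct_comm]; linear_combination hle + hsep⟩
  · refine ⟨_, ?_, ?_, by linear_combination hle + hsep⟩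
    · rw [inv_pow, ← conj_inv]
      exact inv_mem hmemk
    · rw [inv_pow, dist_inv_one]
      exact hk.le

theorem HasLongSquare.limitSet_eq_univ (hq : HasLongSquare S δ q)
    (h : IsDeltaHyperbolic (mulCayley S) δ) (hfin : S.Finite)
    (hQ : ∀ g, ∃ n, 0 < n ∧ g * q ^ n * g⁻¹ ∈ Q) :
    limitSet (mulCayley S) 1 (Q : Set H) = Set.univ :=
  h.limitSet_eq_univ (B := gromovProduct (mulCayley S) 1 q q⁻¹ + 3 * δ + δ) fun g => by
    obtain ⟨n, hn, hmem⟩ := hQ g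
    obtain ⟨r, hr, hlen, hgr⟩ := hq.exists_conj_mem h hfin hn hmem (3 * (mulCayley S).dist g 1)
    exact ⟨_, hr, sub_le_gromovProduct_conj h hgr hlen⟩

end QuasiNormal

end QuasiNormal

theorem theorem17_general {H : Type*} [Group H] (hH : QuasiNormal.IsWordHyperbolic H)
    (Q : Subgroup H) {q : H} (hq : ¬IsOfFinOrder q)
    (hQ : ∀ g, ∃ n, 0 < n ∧ g * q ^ n * g⁻¹ ∈ Q)
    (S : Set H) (hfin : S.Finite) (hgen : Subgroup.closure S = ⊤) :
    QuasiNormal.limitSet (SimpleGraph.mulCayley S) 1 (Q : Set H) = Set.univ := by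
  obtain ⟨δ, h⟩ := QuasiNormal.isGromovHyperbolic_iff_exists.1 (hH.isGromovHyperbolic hfin hgen)
  obtain ⟨_, ⟨k, rfl⟩, hk⟩ := QuasiNormal.exists_hasLongSquare h hfin (infinite_zpowers.2 hq)
  refine hk.limitSet_eq_univ h hfin fun g => ?_
  obtain ⟨n, hn, hmem⟩ := hQ g
  refine ⟨n, hn, ?_⟩
  have hconj : g * (q ^ k) ^ n * g⁻¹ = (g * q ^ n * g⁻¹) ^ k := by
    rw [conj_zpow, ← zpow_natCast, ← zpow_natCast, zpow_comm]
  exact hconj ▸ zpow_mem hmem k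

theorem theorem17 {H : Type*} [Group H] (hH : QuasiNormal.IsWordHyperbolic H)
    (Q : Subgroup H) (hQ : QuasiNormal.IsQuasiNormal Q) (hinf : (Q : Set H).Infinite)
    (S : Set H) (hfin : S.Finite) (hgen : Subgroup.closure S = ⊤) :
    QuasiNormal.limitSet (SimpleGraph.mulCayley S) 1 (Q : Set H) = Set.univ := by
  obtain ⟨q, hqQ, hq⟩ := hH.exists_not_isOfFinOrder hinf
  exact theorem17_general hH Q hq (fun g => hQ.exists_conj_pow_mem g hqQ) S hfin hgen
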